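/- Let $(\Omega,\mathcal F,P)$ be a probability space, $E$ a complete separable metric space, and $\xi:[0,\infty)\times\Omega\to E$ a stochastic process whose paths are RCLL (right continuous with left limits); let $\mathcal F^\xi_t=\sigma(\xi_s:s\le t)$. Let $X:[0,\infty)\times\Omega\to\mathbb R$ be an $\{\mathcal F^\xi_t\}$-progressively measurable process whose paths are RCLL and of bounded variation on compact intervals. Let $\alpha>0$ and $t_0\ge 0$. For an $\mathcal F^\xi_{t_0}$-measurable $Z:\Omega\to\mathbb R$ consider the initial value problem $$dY_t=e^{-\alpha t}\,dX_t\quad(t\in[t_0,\infty)),\qquad Y_{t_0}=Z,$$ that is, pathwise, $Y_{t_0}=Z$ and $Y_t-Y_{t_0}=\int_{(t_0,t]}e^{-\alpha s}\,dX_s$ for all $t\ge t_0$ (Lebesgue--Stieltjes integral). Then for every such $Z$ there is a solution $Y^{(Z)}$, which is pathwise unique on $[t_0,\infty)$, and $Y^{(Z)}_t$ is $\mathcal F^\xi_t$-measurable for $t\ge t_0$. Moreover, for every $t\ge t_0$, $$\mathbb E^P\big[f(Y^{(Z)}_t)\,\big|\,\mathcal F^\xi_{t_0}\big]=\mathbb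 E^P\big[f(Y^{(z)}_t)\,\big|\,\mathcal F^\xi_{t_0}\big]\Big|_{z=Z}\qquad P\text{-a.s.}$$ for all bounded measurable $f:\mathbb R\to\mathbb R$ and all $\mathcal F^\xi_{t_0}$-measurable $Z:\Omega\to\mathbb R$, where the versions to be evaluated at $z=Z$ are regular ones, in the following sense. (a) There is a Markov kernel $Q$ from $(\mathbb R\times\Omega,\mathcal B(\mathbb R)\otimes\mathcal F^\xi_{t_0})$ to $\mathbb R$ such that, for all bounded measurable $f$, all $z\in\mathbb R$ and all $\mathcal F^\xi_{t_0}$-measurable $Z$, $P$-a.s. $$\mathbb E^P[f(Y^{(z)}_t)|\mathcal F^\xi_{t_0}](\omega)=\int f(y)\,Q((z,\omega),dy),\qquad \mathbb E^P[f(Y^{(Z)}_t)|\mathcal F^\xi_{t_0}](\omega)=\int f(y)\,Q((Z(\omega),\omega),dy).$$ (b) If $\kappa$ is any regular conditional probability on $(\Omega,\mathcal F)$ under $P$ given $\mathcal F^\xi_{t_0}$, then for all $f,z,Z$ as in (a), $P$-a.s. $$\mathbb E^P[f(Y^{(z)}_t)|\mathcal F^\xi_{t_0}](\omega)=\int f(Y^{(z)}_t(\omega'))\,\kappa(\omega,d\omega'),\qquad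 \mathbb E^P[f(Y^{(Z)}_t)|\mathcal F^\xi_{t_0}](\omega)=\int f(Y^{(Z(\omega))}_t(\omega'))\,\kappa(\omega,d\omega').$$ -/

import Mathlib

/-!
Every solution is `Y_t = Z + W_t` on `[t₀, ∞)`, where the increment `W_t = ∫_{(t₀,t]} e^{-αs} dX_s`
does not depend on the initial value. The `dX`-masses of intervals contained in `(t₀, t]` are
increments of the path of `X` up to time `t`; by a π-λ argument and approximation by simple
functions, `W_t` is therefore `F t`-measurable. Since `Z` is `F t₀`-measurable, the conditional
expectation of `f(Z + W_t)` given `F t₀` is computed by freezing `Z` and integrating over the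
conditional law of `W_t` given `F t₀`; translating this law by `z` gives the kernel `Q`. A regular
conditional probability `κ` is the conditional law of the identity map of `Ω` given `F t₀`, so the
same freezing argument applies to it.
-/

open MeasureTheory ProbabilityTheory Set Filter Topology
open scoped NNReal ENNReal

namespace QuasiMarkov

/-- A path `x : [0,∞) → E` is RCLL if it is right continuous and has left limits.
(At `t = 0` the left limit condition is void.) -/
structure IsRCLL {E : Type*} [TopologicalSpace E] (x : ℝ≥0 → E) : Prop where
  right_continuous : ∀ t, ContinuousWithinAt x (Ici t) t
  left_limits : ∀ t, ∃ l, Tendsto x (𝓝[<] t) (𝓝 l)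

/-- A path of bounded variation on the compact subintervals of `[0,∞)`, stopped at time `b`,
has bounded variation on the whole of `[0,∞)`. -/
theorem boundedVariationOn_stopped {x : ℝ≥0 → ℝ} (hx : LocallyBoundedVariationOn x univ)
    (b : ℝ≥0) : BoundedVariationOn (fun s => x (min s b)) univ := by
  have h1 : eVariationOn (x ∘ fun s => min s b) univ ≤ eVariationOn x (univ ∩ Icc 0 b) := by
    apply eVariationOn.comp_le_of_monotoneOn
    · intro s _ t _ hst
      exact min_le_min_right b hst
    · intro s _
      exact ⟨mem_univ _, zero_le, min_le_right _ _⟩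
  exact ne_top_of_le_ne_top (hx 0 b (mem_univ _) (mem_univ _)) h1

/-- The Lebesgue--Stieltjes integral `∫_{(a,b]} g(s) dx(s)` along a (right continuous) path `x` of
bounded variation on compact intervals: the integral of `g` over `(a,b]` against the signed
measure `dx`, which gives mass `x v - x u` to every interval `(u,v] ⊆ (a,b]`.
(On `[0,b]` the path `x` agrees with the path stopped at `b`, whose signed measure is finite.) -/
noncomputable def stieltjesIntegral (g : ℝ≥0 → ℝ) {x : ℝ≥0 → ℝ}
    (hx : LocallyBoundedVariationOn x univ) (a b : ℝ≥0) : ℝ :=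
  ∫ᵛ s in Ioc a b, g s ∂•(boundedVariationOn_stopped hx b).vectorMeasure

/-- `Y` is a (pathwise) solution of `dY_t = e^{-αt} dX_t`, `t ∈ [t₀,∞)`, `Y_{t₀} = Z`, where the
paths of `X` have bounded variation on compact intervals. Only the values `Y_t` with
`t ≥ t₀` matter. -/
structure IsSolution {Ω : Type*} (α : ℝ) (t₀ : ℝ≥0) {X : ℝ≥0 → Ω → ℝ}
    (hX : ∀ ω, LocallyBoundedVariationOn (fun s => X s ω) univ)
    (Z : Ω → ℝ) (Y : ℝ≥0 → Ω → ℝ) : Prop where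
  initial : ∀ ω, Y t₀ ω = Z ω
  equation : ∀ ω, ∀ t, t₀ ≤ t →
    Y t ω - Y t₀ ω = stieltjesIntegral (fun s => Real.exp (-α * (s : ℝ))) (hX ω) t₀ t

/-- `κ` is a regular conditional probability on `(Ω, mΩ)` under `P` given the
sub-`σ`-algebra `m`: a Markov kernel from `(Ω, m)` to `(Ω, mΩ)` such that, for every event `A`,
`κ(·, A)` is a version of `P(A | m)`. -/
structure IsRegularCondProb {Ω : Type*} {mΩ : MeasurableSpace Ω} (P : Measure Ω)
    (m : MeasurableSpace Ω) (κ : @Kernel Ω Ω m mΩ) : Prop where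
  isMarkov : ∀ ω, IsProbabilityMeasure (κ ω)
  condProb : ∀ A, MeasurableSet[mΩ] A →
    P[A.indicator (fun _ => (1 : ℝ)) | m] =ᵐ[P] fun ω => (κ ω).real A

end QuasiMarkov

namespace QuasiMarkov

section VectorMeasure

variable {Ω S V : Type*} {m : MeasurableSpace Ω} {mS : MeasurableSpace S}
  [NormedAddCommGroup V] [MeasurableSpace V] [BorelSpace V] [SecondCountableTopology V]
  {ν : Ω → VectorMeasure S V}

theorem measurable_vectorMeasure_of_isPiSystem {𝒞 : Set (Set S)}
    (h_gen : mS = MeasurableSpace.generateFrom 𝒞) (h_pi : IsPiSystem 𝒞)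
    (h_univ : Measurable fun ω => ν ω univ) (h_basic : ∀ s ∈ 𝒞, Measurable fun ω => ν ω s)
    {s : Set S} (hs : MeasurableSet s) : Measurable fun ω => ν ω s := by
  induction s, hs using MeasurableSpace.induction_on_inter h_gen h_pi with
  | empty => simp
  | basic s hs => exact h_basic s hs
  | compl s hs ih =>
    simp_rw [VectorMeasure.of_compl hs]
    exact h_univ.sub ih
  | iUnion s hd hs ih =>
    refine measurable_of_tendsto_metrizable
      (fun n => Finset.measurable_sum (Finset.range n) fun i _ => ih i)
      (tendsto_pi_nhds.2 fun ω => ?_)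
    simpa using (VectorMeasure.hasSum_of_disjoint_iUnion hs hd).tendsto_sum_nat

variable [NormedSpace ℝ V] [CompleteSpace V] [∀ ω, IsFiniteMeasure (ν ω).variation]

theorem measurable_integral_simpleFunc_vectorMeasure
    (hν : ∀ s, MeasurableSet s → Measurable fun ω => ν ω s) (φ : SimpleFunc S ℝ) :
    Measurable fun ω => ∫ᵛ s, φ s ∂•(ν ω) := by
  induction φ using SimpleFunc.induction with
  | @const c s hs =>
    have h_integral (ω : Ω) : ∫ᵛ x, s.indicator (fun _ => c) x ∂•(ν ω) = c • ν ω s := by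
      rw [VectorMeasure.integral_indicator hs]
      simp
    simp_rw [SimpleFunc.coe_piecewise, SimpleFunc.coe_const, Function.const_zero,
      piecewise_eq_indicator]
    exact (funext h_integral).symm ▸ (hν s hs).const_smul c
  | @add φ ψ _ hφ hψ =>
    have h_integral (ω : Ω) :
        ∫ᵛ s, (φ + ψ) s ∂•(ν ω) = ∫ᵛ s, φ s ∂•(ν ω) + ∫ᵛ s, ψ s ∂•(ν ω) :=
      VectorMeasure.integral_add φ.integrable_of_isFiniteMeasure ψ.integrable_of_isFiniteMeasure
    simp_rw [h_integral]
    exact hφ.add hψ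

theorem measurable_integral_vectorMeasure
    (hν : ∀ s, MeasurableSet s → Measurable fun ω => ν ω s) {g : S → ℝ} (hg : Measurable g)
    (hg_int : ∀ ω, (ν ω).Integrable g) : Measurable fun ω => ∫ᵛ s, g s ∂•(ν ω) := by
  let φ := SimpleFunc.approxOn g hg univ 0 (mem_univ _)
  refine measurable_of_tendsto_metrizable
    (fun n => measurable_integral_simpleFunc_vectorMeasure hν (φ n)) (tendsto_pi_nhds.2 fun ω => ?_)
  refine VectorMeasure.tendsto_integral_of_dominated_convergence (fun s => ‖g s‖ + ‖g s‖)
    (fun n => (φ n).measurable.aestronglyMeasurable) ((hg_int ω).norm.add (hg_int ω).norm)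
    (fun n => ae_of_all _ fun s => SimpleFunc.norm_approxOn_zero_le hg (mem_univ _) s n)
    (ae_of_all _ fun s => SimpleFunc.tendsto_approxOn hg (mem_univ _) (by simp))

theorem isFiniteMeasure_variation_signedMeasure (μ : SignedMeasure S) :
    IsFiniteMeasure μ.variation := by
  rw [← SignedMeasure.totalVariation_eq_variation, SignedMeasure.totalVariation]
  infer_instance

end VectorMeasure

section StieltjesIntegral

theorem vectorMeasure_stopped_Ioc {x : ℝ≥0 → ℝ} (hx : LocallyBoundedVariationOn x univ)
    (hx_right : ∀ t, ContinuousWithinAt x (Ici t) t) (b : ℝ≥0) {u v : ℝ≥0} (huv : u ≤ v) :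
    (boundedVariationOn_stopped hx b).vectorMeasure (Ioc u v) = x (min v b) - x (min u b) := by
  have h_rightLim (t : ℝ≥0) : Function.rightLim (fun s => x (min s b)) t = x (min t b) := by
    refine ContinuousWithinAt.rightLim_eq ?_
    exact (hx_right (min t b)).comp (t := Ici (min t b)) (f := fun s => min s b) (by fun_prop)
      fun s hs => min_le_min_right b hs
  rw [BoundedVariationOn.vectorMeasure_Ioc _ huv, h_rightLim, h_rightLim]

variable {Ω : Type*} {m : MeasurableSpace Ω} {X : ℝ≥0 → Ω → ℝ} {a b : ℝ≥0}

theorem measurable_restrict_vectorMeasure_stopped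
    (hX : ∀ ω, LocallyBoundedVariationOn (fun s => X s ω) univ)
    (hX_right : ∀ ω t, ContinuousWithinAt (fun s => X s ω) (Ici t) t)
    (hX_meas : ∀ s ≤ b, Measurable (X s)) {s : Set ℝ≥0} (hs : MeasurableSet s) :
    Measurable fun ω =>
      (boundedVariationOn_stopped (hX ω) b).vectorMeasure.restrict (Ioc a b) s := by
  have h_Ioc (u v : ℝ≥0) : Measurable fun ω =>
      (boundedVariationOn_stopped (hX ω) b).vectorMeasure (Ioc u v) := by
    rcases le_or_gt u v with huv | hvu
    · simp_rw [fun ω => vectorMeasure_stopped_Ioc (hX ω) (hX_right ω) b huv]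
      exact (hX_meas _ (min_le_right _ _)).sub (hX_meas _ (min_le_right _ _))
    · simp [Ioc_eq_empty hvu.not_gt]
  refine measurable_vectorMeasure_of_isPiSystem
    ((BorelSpace.measurable_eq (α := ℝ≥0)).trans (borel_eq_generateFrom_Iic ℝ≥0))
    isPiSystem_Iic (by simpa using h_Ioc a b) ?_ hs
  rintro _ ⟨v, rfl⟩
  have h_inter : Iic v ∩ Ioc a b = Ioc a (min b v) := by grind
  simpa [VectorMeasure.restrict_apply, h_inter] using h_Ioc a (min b v)

theorem measurable_stieltjesIntegral
    (hX : ∀ ω, LocallyBoundedVariationOn (fun s => X s ω) univ)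
    (hX_right : ∀ ω t, ContinuousWithinAt (fun s => X s ω) (Ici t) t)
    (hX_meas : ∀ s ≤ b, Measurable (X s)) {g : ℝ≥0 → ℝ} (hg : Continuous g) :
    Measurable fun ω => stieltjesIntegral g (hX ω) a b := by
  have h_finite (μ : SignedMeasure ℝ≥0) := isFiniteMeasure_variation_signedMeasure μ
  refine measurable_integral_vectorMeasure
    (fun s hs => measurable_restrict_vectorMeasure_stopped hX hX_right hX_meas hs)
    hg.measurable fun ω => ?_
  rw [VectorMeasure.Integrable, VectorMeasure.variation_restrict measurableSet_Ioc]
  exact hg.integrableOn_Ioc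

end StieltjesIntegral

section Conditioning

variable {Ω 𝓧 𝓨 G B : Type*} {m mΩ : MeasurableSpace Ω} {m𝓧 : MeasurableSpace 𝓧}
  {m𝓨 : MeasurableSpace 𝓨} {P : Measure Ω} [IsFiniteMeasure P]
  [NormedAddCommGroup B] [NormedSpace ℝ B] [CompleteSpace B]

theorem hasCondDistrib_condDistrib [StandardBorelSpace 𝓨] [Nonempty 𝓨] {X : Ω → 𝓧} {Y : Ω → 𝓨}
    (hX : AEMeasurable X P) (hY : AEMeasurable Y P) :
    HasCondDistrib Y X (condDistrib Y X P) P :=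
  ⟨hX.prodMk hY, (compProd_map_condDistrib hY).symm⟩

theorem hasCondDistrib_of_setLIntegral_eq {X : Ω → 𝓧} {Y : Ω → 𝓨} {κ : Kernel 𝓧 𝓨}
    [IsFiniteKernel κ] (hX : Measurable X) (hY : Measurable Y)
    (h : ∀ s t, MeasurableSet s → MeasurableSet t →
      ∫⁻ ω in X ⁻¹' s, κ (X ω) t ∂P = P (X ⁻¹' s ∩ Y ⁻¹' t)) :
    HasCondDistrib Y X κ P := by
  refine ⟨(hX.prodMk hY).aemeasurable, Measure.ext_prod fun {s t} hs ht => ?_⟩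
  rw [Measure.map_apply (hX.prodMk hY) (hs.prod ht), Measure.compProd_apply_prod hs ht,
    setLIntegral_map hs (Kernel.measurable_coe κ ht) hX, h s t hs ht, mk_preimage_prod]

theorem condExp_prod_ae_eq_integral_of_hasCondDistrib {X : Ω → 𝓧} {Y : Ω → 𝓨} {κ : Kernel 𝓧 𝓨}
    [IsSFiniteKernel κ] (h : HasCondDistrib Y X κ P) (hX : Measurable X) {f : 𝓧 × 𝓨 → B}
    (hf : StronglyMeasurable f) (hf_int : Integrable (fun ω => f (X ω, Y ω)) P) :
    P[fun ω => f (X ω, Y ω) | m𝓧.comap X] =ᵐ[P] fun ω => ∫ y, f (X ω, y) ∂κ (X ω) := by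
  have hf_int' : Integrable f (P.map X ⊗ₘ κ) := by
    rw [← h.map_eq]
    exact (integrable_map_measure hf.aestronglyMeasurable h.aemeasurable).2 hf_int
  have h_meas : StronglyMeasurable fun x => ∫ y, f (x, y) ∂κ x := hf.integral_kernel_prod_right'
  have h_int : Integrable (fun x => ∫ y, f (x, y) ∂κ x) (P.map X) := by
    simpa using Integrable.integral_compProd (κ := Kernel.const Unit (P.map X))
      (η := Kernel.prodMkLeft Unit κ) hf_int'
  refine (ae_eq_condExp_of_forall_setIntegral_eq hX.comap_le hf_int
    (fun _ _ _ => (h_int.comp_measurable hX).integrableOn) ?_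
    (h_meas.comp_measurable (comap_measurable X)).aestronglyMeasurable).symm
  rintro _ ⟨s, hs, rfl⟩ -
  calc ∫ ω in X ⁻¹' s, ∫ y, f (X ω, y) ∂κ (X ω) ∂P
    _ = ∫ x in s, ∫ y, f (x, y) ∂κ x ∂P.map X :=
      (setIntegral_map hs h_meas.aestronglyMeasurable hX.aemeasurable).symm
    _ = ∫ p in s ×ˢ univ, f p ∂(P.map X ⊗ₘ κ) := by
      simp [Measure.setIntegral_compProd hs .univ hf_int'.integrableOn]
    _ = ∫ ω in X ⁻¹' s, f (X ω, Y ω) ∂P := by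
      rw [← h.map_eq, setIntegral_map (hs.prod .univ) hf.aestronglyMeasurable h.aemeasurable,
        mk_preimage_prod, preimage_univ, inter_univ]

theorem condExp_diag_ae_eq_integral_of_hasCondDistrib (hm : m ≤ mΩ) {W : Ω → 𝓨}
    {κ : Kernel[m] Ω 𝓨} [@IsSFiniteKernel _ _ m _ κ] (h : HasCondDistrib W (id : Ω → Ω) κ P)
    {f : Ω × 𝓨 → B} (hf : StronglyMeasurable[m.prod m𝓨] f)
    (hf_int : Integrable (fun ω => f (ω, W ω)) P) :
    P[fun ω => f (ω, W ω) | m] =ᵐ[P] fun ω => ∫ y, f (ω, y) ∂κ ω := by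
  simpa [MeasurableSpace.comap_id] using
    condExp_prod_ae_eq_integral_of_hasCondDistrib (m𝓧 := m) h (measurable_id'' hm) hf hf_int

theorem condExp_add_ae_eq_integral_of_hasCondDistrib [Add G] [MeasurableSpace G]
    [MeasurableAdd₂ G] (hm : m ≤ mΩ) {V : Ω → 𝓨} {κ : Kernel[m] Ω 𝓨} [@IsSFiniteKernel _ _ m _ κ]
    (h : HasCondDistrib V (id : Ω → Ω) κ P) {Z : Ω → G} (hZ : Measurable[m] Z) {g : 𝓨 → G}
    (hg : Measurable g) {f : G → ℝ} (hf : Measurable f) {C : ℝ} (hC : ∀ x, |f x| ≤ C) :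
    P[fun ω => f (Z ω + g (V ω)) | m] =ᵐ[P] fun ω => ∫ y, f (Z ω + g y) ∂κ ω := by
  have hV : AEMeasurable V P := HasCondDistrib.aemeasurable_snd (m𝓧 := m) h
  have h_meas : Measurable[m.prod m𝓨] fun p : Ω × 𝓨 => f (Z p.1 + g p.2) :=
    hf.comp ((hZ.comp measurable_fst).add (hg.comp measurable_snd))
  have h_sum : AEMeasurable (fun ω => Z ω + g (V ω)) P :=
    (hZ.mono hm le_rfl).aemeasurable.add (hg.comp_aemeasurable hV)
  have h_int : Integrable (fun ω => f (Z ω + g (V ω))) P :=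
    .of_bound (hf.comp_aemeasurable h_sum).aestronglyMeasurable C (ae_of_all _ fun ω => hC _)
  exact condExp_diag_ae_eq_integral_of_hasCondDistrib hm h h_meas.stronglyMeasurable h_int

end Conditioning

section Translation

variable {𝓧 G : Type*} {m𝓧 : MeasurableSpace 𝓧} [Add G] [MeasurableSpace G] [MeasurableAdd₂ G]

/-- The kernel sending `(z, x)` to the law of `z + y`, where `y` has law `R x`. It turns the
conditional law of an increment into the conditional law of the process started at `z`. -/
noncomputable def translationKernel (R : Kernel 𝓧 G) : Kernel (G × 𝓧) G :=
  (Kernel.id ∥ₖ R).map fun p => p.1 + p.2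

instance (R : Kernel 𝓧 G) [IsMarkovKernel R] : IsMarkovKernel (translationKernel R) :=
  Kernel.IsMarkovKernel.map _ measurable_add

theorem translationKernel_apply (R : Kernel 𝓧 G) [IsSFiniteKernel R] (z : G) (x : 𝓧) :
    translationKernel R (z, x) = (R x).map fun y => z + y := by
  rw [translationKernel, Kernel.map_apply _ measurable_add, Kernel.parallelComp_apply,
    Kernel.id_apply, Measure.dirac_prod, Measure.map_map measurable_add measurable_prodMk_left]
  rfl

variable {Ω : Type*} {m mΩ : MeasurableSpace Ω} {P : Measure Ω} [IsFiniteMeasure P]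

theorem exists_kernel_condExp_add_ae_eq_integral [StandardBorelSpace G] [Nonempty G] (hm : m ≤ mΩ)
    {W : Ω → G} (hW : Measurable W) :
    ∃ Q : @Kernel (G × Ω) G (MeasurableSpace.prod inferInstance m) inferInstance,
      (∀ p, IsProbabilityMeasure (Q p)) ∧
      ∀ f : G → ℝ, Measurable f → (∃ C, ∀ y, |f y| ≤ C) → ∀ Z : Ω → G, Measurable[m] Z →
        P[fun ω => f (Z ω + W ω) | m] =ᵐ[P] fun ω => ∫ y, f y ∂(Q (Z ω, ω)) := by
  let R : Kernel[m] Ω G := @condDistrib Ω Ω G _ _ _ _ m W id P _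
  have h_markov : @IsMarkovKernel _ _ m _ R := by unfold R; infer_instance
  have hR : HasCondDistrib W (id : Ω → Ω) R P :=
    hasCondDistrib_condDistrib (m𝓧 := m)
      (@Measurable.aemeasurable _ _ _ m _ _ (measurable_id'' hm)) hW.aemeasurable
  refine ⟨translationKernel (m𝓧 := m) R, fun p => inferInstance, ?_⟩
  rintro f hf ⟨C, hC⟩ Z hZ
  refine (condExp_add_ae_eq_integral_of_hasCondDistrib hm hR hZ measurable_id hf hC).trans
    (ae_of_all _ fun ω => ?_)
  simp only [translationKernel_apply]
  exact (integral_map (measurable_const_add _).aemeasurable hf.aestronglyMeasurable).symm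

end Translation

section RegularCondProb

variable {Ω : Type*} {m mΩ : MeasurableSpace Ω} {P : Measure Ω} {κ : Kernel[m] Ω Ω}

theorem IsRegularCondProb.isMarkovKernel (hκ : IsRegularCondProb P m κ) :
    @IsMarkovKernel _ _ m _ κ :=
  @IsMarkovKernel.mk _ _ m _ κ hκ.isMarkov

variable [IsFiniteMeasure P]

theorem IsRegularCondProb.setLIntegral_apply (hκ : IsRegularCondProb P m κ) (hm : m ≤ mΩ)
    {s A : Set Ω} (hs : MeasurableSet[m] s) (hA : MeasurableSet A) :
    ∫⁻ ω in s, κ ω A ∂P = P (s ∩ A) := by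
  have := hκ.isMarkov
  have h_fin : ∫⁻ ω in s, κ ω A ∂P ≠ ∞ :=
    ne_top_of_le_ne_top (by simp) (lintegral_mono fun ω => prob_le_one (μ := κ ω))
  rw [← ENNReal.toReal_eq_toReal_iff' h_fin (measure_ne_top _ _)]
  calc (∫⁻ ω in s, κ ω A ∂P).toReal
    _ = ∫ ω in s, (κ ω).real A ∂P :=
      (integral_toReal ((κ.measurable_coe hA).mono hm le_rfl).aemeasurable
        (ae_of_all _ fun ω => measure_lt_top _ _)).symm
    _ = ∫ ω in s, (P[A.indicator fun _ => (1 : ℝ) | m]) ω ∂P :=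
      (integral_congr_ae (ae_restrict_of_ae (hκ.condProb A hA))).symm
    _ = ∫ ω in s, A.indicator (fun _ => (1 : ℝ)) ω ∂P :=
      setIntegral_condExp hm ((integrable_const _).indicator hA) hs
    _ = (P (s ∩ A)).toReal := by simp [setIntegral_indicator hA, measureReal_def]

theorem IsRegularCondProb.hasCondDistrib_id (hκ : IsRegularCondProb P m κ) (hm : m ≤ mΩ) :
    @HasCondDistrib Ω Ω Ω mΩ m mΩ id id κ P := by
  have := hκ.isMarkovKernel
  exact hasCondDistrib_of_setLIntegral_eq (m𝓧 := m) (measurable_id'' hm) measurable_id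
    fun s A hs hA => hκ.setLIntegral_apply hm hs hA

end RegularCondProb

section Solution

variable {Ω : Type*} {α : ℝ} {t₀ t : ℝ≥0} {X : ℝ≥0 → Ω → ℝ} {Z : Ω → ℝ} {Y Y' : ℝ≥0 → Ω → ℝ}
  {hX : ∀ ω, LocallyBoundedVariationOn (fun s => X s ω) univ}

/-- The increment `∫_{(t₀,t]} e^{-αs} dX_s`, for `t ≥ t₀` common to all solutions of the initial
value problem, whatever their initial value. -/
noncomputable def increment (α : ℝ) (t₀ : ℝ≥0)
    (hX : ∀ ω, LocallyBoundedVariationOn (fun s => X s ω) univ) (t : ℝ≥0) (ω : Ω) : ℝ :=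
  stieltjesIntegral (fun s => Real.exp (-α * (s : ℝ))) (hX ω) t₀ t

theorem increment_self (ω : Ω) : increment α t₀ hX t₀ ω = 0 := by
  simp [increment, stieltjesIntegral]

theorem isSolution_add_increment (Z : Ω → ℝ) :
    IsSolution α t₀ hX Z fun t ω => Z ω + increment α t₀ hX t ω where
  initial ω := by rw [increment_self, add_zero]
  equation ω t _ := by rw [increment_self, add_zero, add_sub_cancel_left, increment]

theorem IsSolution.eq_add_increment (hY : IsSolution α t₀ hX Z Y) (ht : t₀ ≤ t) (ω : Ω) :
    Y t ω = Z ω + increment α t₀ hX t ω := by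
  rw [← hY.initial ω]
  exact eq_add_of_sub_eq' (hY.equation ω t ht)

theorem IsSolution.eqOn_Ici (hY : IsSolution α t₀ hX Z Y) (hY' : IsSolution α t₀ hX Z Y') :
    EqOn Y Y' (Ici t₀) := fun t ht => funext fun ω => by
  rw [hY.eq_add_increment ht, hY'.eq_add_increment ht]

theorem measurable_increment {m : MeasurableSpace Ω}
    (hX_right : ∀ ω t, ContinuousWithinAt (fun s => X s ω) (Ici t) t)
    (hX_meas : ∀ s ≤ t, Measurable (X s)) : Measurable (increment α t₀ hX t) :=
  measurable_stieltjesIntegral hX hX_right hX_meas (by fun_prop)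

end Solution

end QuasiMarkov

open QuasiMarkov in
theorem mainTheorem8_general {Ω : Type*} {mΩ : MeasurableSpace Ω} (P : Measure Ω)
    [IsFiniteMeasure P] (F : Filtration ℝ≥0 mΩ) (X : ℝ≥0 → Ω → ℝ) (hX_adapted : Adapted F X)
    (hX_right : ∀ ω t, ContinuousWithinAt (fun s => X s ω) (Ici t) t)
    (hX : ∀ ω, LocallyBoundedVariationOn (fun s => X s ω) univ) (α : ℝ) (t₀ : ℝ≥0) :
    (∀ Z : Ω → ℝ, Measurable[F t₀] Z →
      (∃ Y, IsSolution α t₀ hX Z Y) ∧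
      ∀ Y Y', IsSolution α t₀ hX Z Y → IsSolution α t₀ hX Z Y' →
        ∀ t, t₀ ≤ t → ∀ ω, Y t ω = Y' t ω) ∧
    ∀ Y : (Ω → ℝ) → ℝ≥0 → Ω → ℝ,
      (∀ Z : Ω → ℝ, Measurable[F t₀] Z → IsSolution α t₀ hX Z (Y Z)) →
      ∀ t, t₀ ≤ t →
        (∀ Z : Ω → ℝ, Measurable[F t₀] Z → Measurable[F t] (Y Z t)) ∧
        (∃ Q : @Kernel (ℝ × Ω) ℝ (MeasurableSpace.prod inferInstance (F t₀)) inferInstance,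
          (∀ p, IsProbabilityMeasure (Q p)) ∧
          ∀ f : ℝ → ℝ, Measurable f → (∃ C, ∀ y, |f y| ≤ C) →
            (∀ z : ℝ, P[fun ω => f (Y (fun _ => z) t ω) | F t₀] =ᵐ[P]
              fun ω => ∫ y, f y ∂(Q (z, ω))) ∧
            ∀ Z : Ω → ℝ, Measurable[F t₀] Z →
              P[fun ω => f (Y Z t ω) | F t₀] =ᵐ[P] fun ω => ∫ y, f y ∂(Q (Z ω, ω))) ∧
        ∀ κ : Kernel[F t₀] Ω Ω, IsRegularCondProb P (F t₀) κ →
          ∀ f : ℝ → ℝ, Measurable f → (∃ C, ∀ y, |f y| ≤ C) →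
            (∀ z : ℝ, P[fun ω => f (Y (fun _ => z) t ω) | F t₀] =ᵐ[P]
              fun ω => ∫ ω', f (Y (fun _ => z) t ω') ∂(κ ω)) ∧
            ∀ Z : Ω → ℝ, Measurable[F t₀] Z →
              P[fun ω => f (Y Z t ω) | F t₀] =ᵐ[P]
                fun ω => ∫ ω', f (Y (fun _ => Z ω) t ω') ∂(κ ω) := by
  refine ⟨fun Z _ => ⟨⟨_, isSolution_add_increment Z⟩,
    fun Y Y' hY hY' t ht ω => congrFun (hY.eqOn_Ici hY' ht) ω⟩, fun Y hY t ht => ?_⟩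
  have hW : Measurable[F t] (increment α t₀ hX t) :=
    measurable_increment hX_right fun s hs => (hX_adapted s).mono (F.mono hs) le_rfl
  have hW' : Measurable (increment α t₀ hX t) := hW.mono (F.le t) le_rfl
  have h_eq (Z : Ω → ℝ) (hZ : Measurable[F t₀] Z) : Y Z t = fun ω => Z ω + increment α t₀ hX t ω :=
    funext ((hY Z hZ).eq_add_increment ht)
  have h_const (z : ℝ) : Measurable[F t₀] fun _ : Ω => z := @measurable_const _ _ _ (F t₀) z
  refine ⟨fun Z hZ => ?_, ?_, fun κ hκ f hf ⟨C, hC⟩ => ?_⟩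
  · rw [h_eq Z hZ]
    exact (hZ.mono (F.mono ht) le_rfl).add hW
  · obtain ⟨Q, hQ, hQW⟩ := exists_kernel_condExp_add_ae_eq_integral (P := P) (F.le t₀) hW'
    refine ⟨Q, hQ, fun f hf hC => ?_⟩
    have h_Q (Z : Ω → ℝ) (hZ : Measurable[F t₀] Z) :
        P[fun ω => f (Y Z t ω) | F t₀] =ᵐ[P] fun ω => ∫ y, f y ∂(Q (Z ω, ω)) := by
      simpa only [h_eq Z hZ] using hQW f hf hC Z hZ
    exact ⟨fun z => h_Q _ (h_const z), h_Q⟩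
  · have := hκ.isMarkovKernel
    have h_κ (Z : Ω → ℝ) (hZ : Measurable[F t₀] Z) : P[fun ω => f (Y Z t ω) | F t₀] =ᵐ[P]
        fun ω => ∫ ω', f (Y (fun _ => Z ω) t ω') ∂(κ ω) := by
      simp only [h_eq Z hZ, h_eq _ (h_const _)]
      exact condExp_add_ae_eq_integral_of_hasCondDistrib (F.le t₀) (hκ.hasCondDistrib_id (F.le t₀))
        hZ hW' hf hC
    exact ⟨fun z => h_κ _ (h_const z), h_κ⟩

theorem mainTheorem8 {Ω E : Type*} [MeasurableSpace Ω] (P : Measure Ω) [IsProbabilityMeasure P]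
    [MetricSpace E] [CompleteSpace E] [SecondCountableTopology E]
    [MeasurableSpace E] [BorelSpace E]
    (ξ : ℝ≥0 → Ω → E) (hξ : ∀ t, Measurable (ξ t))
    (hξ_rcll : ∀ ω, QuasiMarkov.IsRCLL (fun t => ξ t ω))
    (F : Filtration ℝ≥0 ‹MeasurableSpace Ω›)
    (hF : F = Filtration.natural ξ (fun t => (hξ t).stronglyMeasurable))
    (X : ℝ≥0 → Ω → ℝ) (hX_prog : IsProgressive F X)
    (hX_rcll : ∀ ω, QuasiMarkov.IsRCLL (fun t => X t ω))
    (hX_bv : ∀ ω, LocallyBoundedVariationOn (fun t => X t ω) univ)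
    (α : ℝ) (hα : 0 < α) (t₀ : ℝ≥0) :
    -- for every initial value, the problem has a solution, and it is pathwise unique on `[t₀,∞)`
    (∀ Z : Ω → ℝ, Measurable[F t₀] Z →
      (∃ Y, QuasiMarkov.IsSolution α t₀ hX_bv Z Y) ∧
      ∀ Y Y', QuasiMarkov.IsSolution α t₀ hX_bv Z Y → QuasiMarkov.IsSolution α t₀ hX_bv Z Y' →
        ∀ t, t₀ ≤ t → ∀ ω, Y t ω = Y' t ω) ∧
    -- `Y Z` denotes the solution with initial value `Z`
    ∀ Y : (Ω → ℝ) → ℝ≥0 → Ω → ℝ,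
      (∀ Z : Ω → ℝ, Measurable[F t₀] Z → QuasiMarkov.IsSolution α t₀ hX_bv Z (Y Z)) →
      ∀ t, t₀ ≤ t →
        (∀ Z : Ω → ℝ, Measurable[F t₀] Z → Measurable[F t] (Y Z t)) ∧
        -- the conditional laws of `Y_t^{(z)}` given `F t₀` have versions `Q (z, ·)`, jointly
        -- measurable in `(z, ω)`, for which the substitution `z = Z` is correct
        (∃ Q : @Kernel (ℝ × Ω) ℝ (MeasurableSpace.prod inferInstance (F t₀)) inferInstance,
          (∀ p, IsProbabilityMeasure (Q p)) ∧
          ∀ f : ℝ → ℝ, Measurable f → (∃ C, ∀ y, |f y| ≤ C) →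
            (∀ z : ℝ, P[fun ω => f (Y (fun _ => z) t ω) | F t₀] =ᵐ[P]
              fun ω => ∫ y, f y ∂(Q (z, ω))) ∧
            ∀ Z : Ω → ℝ, Measurable[F t₀] Z →
              P[fun ω => f (Y Z t ω) | F t₀] =ᵐ[P] fun ω => ∫ y, f y ∂(Q (Z ω, ω))) ∧
        -- the substitution is also correct for the versions computed from any regular
        -- conditional probability given `F t₀`
        ∀ κ : @Kernel Ω Ω (F t₀) ‹MeasurableSpace Ω›,
          QuasiMarkov.IsRegularCondProb P (F t₀) κ →
          ∀ f : ℝ → ℝ, Measurable f → (∃ C, ∀ y, |f y| ≤ C) →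
            (∀ z : ℝ, P[fun ω => f (Y (fun _ => z) t ω) | F t₀] =ᵐ[P]
              fun ω => ∫ ω', f (Y (fun _ => z) t ω') ∂(κ ω)) ∧
            ∀ Z : Ω → ℝ, Measurable[F t₀] Z →
              P[fun ω => f (Y Z t ω) | F t₀] =ᵐ[P]
                fun ω => ∫ ω', f (Y (fun _ => Z ω) t ω') ∂(κ ω) :=
  mainTheorem8_general P F X hX_prog.adapted
    (fun ω => (hX_rcll ω).right_continuous) hX_bv α t₀
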